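/- Let $\mathcal B$ be a unital $C^*$-algebra. A Hilbert $\mathcal B$-$\mathcal B$ module is a (complete) right Hilbert $\mathcal B$-module with a unital left action of $\mathcal B$ satisfying $\langle bx,y\rangle=\langle x,b^*y\rangle$. The inner tensor product $E\otimes F$ of two such modules is the completion of their algebraic tensor product, modulo vectors of length zero, in the inner product $\langle u\otimes v,u_1\otimes v_1\rangle=\langle v,\langle u,u_1\rangle v_1\rangle$. A product system $E$ over $\mathcal B$ is a family $(E_t)_{t\ge0}$ of Hilbert $\mathcal B$-$\mathcal B$ modules with an identification $E_0\cong\mathcal B$ and unitary bimodule isomorphisms $\varphi_{t,s}:E_t\otimes E_s\to E_{t+s}$ (associativity of the $\varphi_{t,s}$ is allowed but not needed). A unit on $E$ is a family $\xi_t\in E_t$, $t\ge0$, with $\xi_0=1$ and $\varphi_{t,s}(\xi_t\otimes\xi_s)=\xi_{t+s}$ for all $s,t\ge0$. For units $\xi,\eta$ let $\mathcal K^{\xi,\eta}_t\in L(\mathcal B)$ be the bounded operator $\mathcal K^{\xi,\eta}_t(b)=\langle\xi_t,b\eta_t\rangle$. A set $S$ of units is called continuous if for all $\xi,\eta\in S$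 the map $t\mapsto\mathcal K^{\xi,\eta}_t$ from $[0,\infty)$ to $L(\mathcal B)$ is continuous in the operator norm; a unit $\xi$ is called continuous if the set $\{\xi\}$ is continuous. Proposition. Let $\mathcal U$ be the set of all continuous units on a product system $E$ over $\mathcal B$. The relation $$x\sim y\iff\{x,y\}\text{ is a continuous set}$$ is an equivalence relation on $\mathcal U$. Its equivalence classes are exactly the nonempty maximal (with respect to inclusion) continuous sets of units on $E$; hence these maximal continuous sets are mutually disjoint and their union is $\mathcal U$. -/

import Mathlib

open scoped TensorProduct NNReal RightActions

universe u v

/-- A Hilbert `B`-`B` module over a unital C⋆-algebra `B`: a complete right Hilbert `B`-module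
together with a unital left action of `B` by adjointable operators (a unital `⋆`-representation of
`B`), compatible with the complex vector space structure.

Mathlib's `CStarModule A E` pulls scalars out of the inner product on the left:
`⟪x, a • y⟫ = a * ⟪x, y⟫`. A right Hilbert `B`-module is therefore a `CStarModule` over the opposite
algebra `Bᵐᵒᵖ`, whose module structures are the right `B`-module structures, `x <• b` standing for
`MulOpposite.op b • x`. -/
class HilbertBimodule (B : Type u) (E : Type v) [CStarAlgebra B] [PartialOrder B]
    [NormedAddCommGroup E] [NormedSpace ℂ E] [Module B E] [Module Bᵐᵒᵖ E]
    extends CStarModule Bᵐᵒᵖ E where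
  complete : CompleteSpace E
  /-- `(b x) b' = b (x b')`. -/
  smul_comm : SMulCommClass B Bᵐᵒᵖ E
  complex_left : IsScalarTower ℂ B E
  complex_right : IsScalarTower ℂ Bᵐᵒᵖ E
  /-- `⟨b x, y⟩ = ⟨x, b⋆ y⟩`. -/
  inner_left_smul (b : B) (x y : E) : inner (b • x) y = inner x (star b • y)

namespace HilbertBimodule

variable {B : Type u} [CStarAlgebra B] [PartialOrder B]
variable {E : Type v} [NormedAddCommGroup E] [NormedSpace ℂ E] [Module B E] [Module Bᵐᵒᵖ E]
  [HilbertBimodule B E]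

variable (B) in
/-- The `B`-valued inner product of a Hilbert `B`-`B` module. It is conjugate linear in the first
variable and linear in the second one, and `⟨x, y b⟩ = ⟨x, y⟩ b`. -/
def ip (x y : E) : B := MulOpposite.unop (inner Bᵐᵒᵖ x y)

theorem ip_add_right (x y z : E) : ip B x (y + z) = ip B x y + ip B x z := by
  simp [ip]

theorem ip_add_left (x y z : E) : ip B (x + y) z = ip B x z + ip B y z := by
  simp [ip]

theorem ip_smul_right (c : ℂ) (x y : E) : ip B x (c • y) = c • ip B x y := by
  simp [ip]

theorem ip_smul_left (c : ℂ) (x y : E) : ip B (c • x) y = star c • ip B x y := by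
  simp [ip]

theorem ip_right_action (b : B) (x y : E) : ip B x (y <• b) = ip B x y * b := by
  simp [ip]

theorem star_ip (x y : E) : star (ip B x y) = ip B y x := by
  simp [ip, ← MulOpposite.unop_star]

theorem ip_left_smul (b : B) (x y : E) : ip B (b • x) y = ip B x (star b • y) :=
  congrArg MulOpposite.unop (inner_left_smul b x y)

theorem ip_self_nonneg (x : E) : 0 ≤ ip B x x :=
  CStarModule.inner_self_nonneg (A := Bᵐᵒᵖ) (x := x)

theorem smul_left_smul (c : ℂ) (b : B) (x : E) : (c • b) • x = c • (b • x) :=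
  (complex_left (B := B) (E := E)).smul_assoc c b x

theorem norm_sq_eq (x : E) : ‖x‖ ^ 2 = ‖ip B x x‖ :=
  CStarModule.norm_sq_eq Bᵐᵒᵖ (x := x)

variable [StarOrderedRing B]

theorem norm_ip_le (x y : E) : ‖ip B x y‖ ≤ ‖x‖ * ‖y‖ :=
  CStarModule.norm_inner_le (A := Bᵐᵒᵖ) E (x := x) (y := y)

/-- The left action of a Hilbert bimodule is contractive. -/
theorem norm_smul_le' (b : B) (x : E) : ‖b • x‖ ≤ ‖b‖ * ‖x‖ := by
  have h1 : (0 : B) ≤ algebraMap ℝ B (‖b‖ ^ 2) - star b * b :=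
    sub_nonneg.2 CStarAlgebra.star_mul_le_algebraMap_norm_sq
  obtain ⟨c, hc⟩ := CStarAlgebra.nonneg_iff_eq_star_mul_self.1 h1
  have h2 : ip B (b • x) (b • x) + ip B (c • x) (c • x)
      = ((‖b‖ ^ 2 : ℝ) : ℂ) • ip B x x := by
    rw [ip_left_smul, ip_left_smul, smul_smul, smul_smul, ← ip_add_right, ← add_smul, ← hc,
      add_sub_cancel, ← ip_smul_right, ← one_smul B x, ← smul_left_smul, one_smul]
    congr 2
    rw [Algebra.algebraMap_eq_smul_one, ← Complex.coe_smul]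
  have h3 : ip B (b • x) (b • x) ≤ ((‖b‖ ^ 2 : ℝ) : ℂ) • ip B x x := by
    rw [← h2]; exact le_add_of_nonneg_right (ip_self_nonneg _)
  have h4 := CStarAlgebra.norm_le_norm_of_nonneg_of_le (ip_self_nonneg _) h3
  rw [norm_smul, ← norm_sq_eq, ← norm_sq_eq, Complex.norm_real, Real.norm_of_nonneg (by positivity),
    ← mul_pow] at h4
  exact (pow_le_pow_iff_left₀ (norm_nonneg _) (by positivity) two_ne_zero).1 h4

end HilbertBimodule

open HilbertBimodule

section InnerTensorProduct

variable (B : Type u) [CStarAlgebra B] [PartialOrder B]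
variable (E F : Type v)
  [NormedAddCommGroup E] [NormedSpace ℂ E] [Module B E] [Module Bᵐᵒᵖ E] [HilbertBimodule B E]
  [NormedAddCommGroup F] [NormedSpace ℂ F] [Module B F] [Module Bᵐᵒᵖ F] [HilbertBimodule B F]

/-- The `B`-valued sesquilinear form on the algebraic tensor product of two Hilbert `B`-`B` modules
that is determined by `⟨x ⊗ y, x' ⊗ y'⟩ = ⟨y, ⟨x, x'⟩ y'⟩`. The inner tensor product of `E` and `F`
is the Hilbert `B`-`B` module obtained from `E ⊗ F` and this form by dividing out the vectors of
length zero (among them all `x b ⊗ y - x ⊗ b y`) and completing. -/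
noncomputable def innerTensorForm : E ⊗[ℂ] F →ₗ⋆[ℂ] E ⊗[ℂ] F →ₗ[ℂ] B :=
  TensorProduct.lift <|
    LinearMap.mk₂'ₛₗ (starRingEnd ℂ) (starRingEnd ℂ)
      (fun x y => TensorProduct.lift <|
        LinearMap.mk₂ ℂ (fun x' y' => ip B y (ip B x x' • y'))
          (fun _ _ _ => by rw [ip_add_right, add_smul, ip_add_right])
          (fun _ _ _ => by rw [ip_smul_right, smul_left_smul, ip_smul_right])
          (fun _ _ _ => by rw [smul_add, ip_add_right])
          (fun c x' y' => by
            rw [← ip_smul_right, ← smul_left_smul, ← one_smul B y', ← smul_left_smul, smul_smul,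
              smul_smul]
            simp))
      (fun _ _ _ => by
        ext; simp [ip_add_left, ip_add_right, add_smul])
      (fun _ _ _ => by
        ext; simp [ip_smul_left, ip_smul_right, smul_left_smul])
      (fun _ _ _ => by
        ext; simp [ip_add_left])
      (fun _ _ _ => by
        ext; simp [ip_smul_left])

@[simp]
theorem innerTensorForm_tmul (x x' : E) (y y' : F) :
    innerTensorForm B E F (x ⊗ₜ y) (x' ⊗ₜ y') = ip B y (ip B x x' • y') := rfl

/-- A unitary isomorphism of Hilbert `B`-`B` modules from the inner tensor product of `E` and `F`
onto `G`. As the inner tensor product is the completion of the algebraic tensor product for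
`innerTensorForm`, such an isomorphism is the same as a linear map on the algebraic tensor product
that carries this form to the inner product of `G`, has dense range, and respects both actions
`b (x ⊗ y) = b x ⊗ y` and `(x ⊗ y) b = x ⊗ y b`. -/
structure InnerTensorUnitary (G : Type v)
    [NormedAddCommGroup G] [NormedSpace ℂ G] [Module B G] [Module Bᵐᵒᵖ G]
    [HilbertBimodule B G] where
  toLinearMap : E ⊗[ℂ] F →ₗ[ℂ] G
  ip_map (z w : E ⊗[ℂ] F) :
    ip B (toLinearMap z) (toLinearMap w) = innerTensorForm B E F z w
  denseRange : DenseRange toLinearMap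
  map_left (b : B) (x : E) (y : F) :
    toLinearMap ((b • x) ⊗ₜ y) = b • toLinearMap (x ⊗ₜ y)
  map_right (b : B) (x : E) (y : F) :
    toLinearMap (x ⊗ₜ (y <• b)) = toLinearMap (x ⊗ₜ y) <• b

end InnerTensorProduct

/-- A product system over the unital C⋆-algebra `B`: a family `(E t)`, `t ≥ 0`, of Hilbert
`B`-`B` modules, an identification `E 0 ≅ B` of Hilbert `B`-`B` modules (where `⟨a, b⟩ = a⋆ b` on
`B`), and unitary isomorphisms `E t ⊗ E s → E (t + s)` from the inner tensor products. Neither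
associativity of the products nor any compatibility of them with the identification `E 0 ≅ B` is
demanded; systems that have these properties are particular cases. -/
structure ProductSystem (B : Type u) [CStarAlgebra B] [PartialOrder B]
    (E : ℝ≥0 → Type v) [∀ t, NormedAddCommGroup (E t)] [∀ t, NormedSpace ℂ (E t)]
    [∀ t, Module B (E t)] [∀ t, Module Bᵐᵒᵖ (E t)] [∀ t, HilbertBimodule B (E t)] where
  zeroIso : E 0 ≃ₗ[ℂ] B
  zeroIso_left (b : B) (x : E 0) : zeroIso (b • x) = b * zeroIso x
  zeroIso_right (b : B) (x : E 0) : zeroIso (x <• b) = zeroIso x * b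
  zeroIso_ip (x y : E 0) : star (zeroIso x) * zeroIso y = ip B x y
  mul (t s : ℝ≥0) : InnerTensorUnitary B (E t) (E s) (E (t + s))

namespace ProductSystem

variable {B : Type u} [CStarAlgebra B] [PartialOrder B]
variable {E : ℝ≥0 → Type v} [∀ t, NormedAddCommGroup (E t)] [∀ t, NormedSpace ℂ (E t)]
  [∀ t, Module B (E t)] [∀ t, Module Bᵐᵒᵖ (E t)] [∀ t, HilbertBimodule B (E t)]

/-- A unit of a product system: a family `ξ t ∈ E t` with `ξ 0 = 1` and
`ξ t ⊗ ξ s = ξ (t + s)`. -/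
structure Unit (P : ProductSystem B E) where
  val (t : ℝ≥0) : E t
  val_zero : P.zeroIso (val 0) = 1
  mul_val (t s : ℝ≥0) : (P.mul t s).toLinearMap (val t ⊗ₜ val s) = val (t + s)

variable [StarOrderedRing B] {P : ProductSystem B E}

/-- The bounded linear operator `b ↦ ⟨ξ t, b (η t)⟩` on `B`. -/
noncomputable def kernel (ξ η : P.Unit) (t : ℝ≥0) : B →L[ℂ] B :=
  LinearMap.mkContinuous
    { toFun := fun b => ip B (ξ.val t) (b • η.val t)
      map_add' := fun a b => by rw [add_smul, ip_add_right]
      map_smul' := fun c b => by rw [smul_left_smul, ip_smul_right]; rfl }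
    (‖ξ.val t‖ * ‖η.val t‖)
    (fun b => (norm_ip_le _ _).trans <| by
      rw [mul_assoc, mul_comm ‖η.val t‖]
      exact mul_le_mul_of_nonneg_left (norm_smul_le' b _) (norm_nonneg _))

@[simp]
theorem kernel_apply (ξ η : P.Unit) (t : ℝ≥0) (b : B) :
    kernel ξ η t b = ip B (ξ.val t) (b • η.val t) := rfl

/-- A set `S` of units is continuous if for all `ξ, η ∈ S` the family `kernel ξ η t`, `t ≥ 0`, is
continuous for the operator norm. -/
def IsContinuousSet (S : Set P.Unit) : Prop :=
  ∀ ξ ∈ S, ∀ η ∈ S, Continuous (kernel ξ η)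

/-- A unit `ξ` is (uniformly) continuous if `{ξ}` is a continuous set. -/
def Unit.IsContinuous (ξ : P.Unit) : Prop :=
  IsContinuousSet {ξ}

end ProductSystem

/-!
Each kernel `t ↦ kernel ξ η t` is a one-parameter semigroup in the Banach algebra of bounded
operators on `B`, so it is norm continuous as soon as it is norm continuous at `0`, where its value
is the identity (`continuous_of_add_eq_mul`, `ProductSystem.continuous_kernel_iff`). Although the
fibres `E t` carry no common topology, two continuous units can be compared
fibrewise: `{ξ, η}` is continuous if and only if `‖ξ t - η t‖ → 0` as `t → 0`
(`ProductSystem.isContinuousSet_pair_iff`). Indeed `‖ξ t - η t‖ ^ 2` is the norm of a combination of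
the four kernels evaluated at `1`; conversely `kernel ξ η t` differs from `kernel ξ ξ t` by at most
`‖ξ t‖ * ‖η t - ξ t‖`. With this description, transitivity is the triangle inequality. The
statement on maximal continuous sets follows, because a set of units is continuous exactly if all
of its pairs are.
-/

open scoped Topology
open Filter

/-- A one-parameter semigroup in a Banach algebra that is continuous at `0` is continuous. Elements
close to `1` are invertible, which gives continuity from the left without boundedness estimates. -/
theorem continuous_of_add_eq_mul {A : Type*} [NormedRing A] [HasSummableGeomSeries A]
    {T : ℝ≥0 → A} (h0 : T 0 = 1) (hadd : ∀ t s, T (t + s) = T t * T s) (hT : ContinuousAt T 0) :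
    Continuous T := by
  rw [continuous_iff_continuousAt]
  intro t
  have hr : Tendsto (fun s : ℝ≥0 => s - t) (𝓝 t) (𝓝 0) := by
    have : Continuous fun s : ℝ≥0 => s - t := by fun_prop
    simpa using this.tendsto t
  have hl : Tendsto (fun s : ℝ≥0 => t - s) (𝓝 t) (𝓝 0) := by
    have : Continuous fun s : ℝ≥0 => t - s := by fun_prop
    simpa using this.tendsto t
  rw [ContinuousAt, h0] at hT
  have hinv : Tendsto (Ring.inverse : A → A) (𝓝 1) (𝓝 1) := by
    simpa [ContinuousAt] using NormedRing.inverse_continuousAt (1 : Aˣ)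
  have hlim : Tendsto (fun s => T t * T (s - t) * Ring.inverse (T (t - s))) (𝓝 t) (𝓝 (T t)) := by
    simpa using (tendsto_const_nhds.mul (hT.comp hr)).mul (hinv.comp (hT.comp hl))
  have hunit : ∀ᶠ s in 𝓝 t, IsUnit (T (t - s)) :=
    (hT.comp hl).eventually (Units.nhds (1 : Aˣ))
  refine hlim.congr' ?_
  filter_upwards [hunit] with s hs
  -- with truncated subtraction, `s + (t - s) = max s t = t + (s - t)`
  have : T t * T (s - t) = T s * T (t - s) := by
    rw [← hadd, ← hadd, add_tsub_eq_max, add_tsub_eq_max, max_comm]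
  rw [this, mul_assoc, Ring.mul_inverse_cancel _ hs, mul_one]

namespace ProductSystem

variable {B : Type u} [CStarAlgebra B] [PartialOrder B] [StarOrderedRing B]
  {E : ℝ≥0 → Type v} [∀ t, NormedAddCommGroup (E t)] [∀ t, NormedSpace ℂ (E t)]
  [∀ t, Module B (E t)] [∀ t, Module Bᵐᵒᵖ (E t)] [∀ t, HilbertBimodule B (E t)]
  {P : ProductSystem B E}

theorem kernel_zero (ξ η : P.Unit) : kernel ξ η 0 = 1 := by
  ext b
  rw [kernel_apply, ← P.zeroIso_ip, P.zeroIso_left, ξ.val_zero, η.val_zero]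
  simp

theorem kernel_add (ξ η : P.Unit) (t s : ℝ≥0) :
    kernel ξ η (t + s) = kernel ξ η t * kernel ξ η s := by
  -- `⟨ξ t ⊗ ξ s, b (η t ⊗ η s)⟩ = ⟨ξ s, ⟨ξ t, b (η t)⟩ (η s)⟩` composes in the other order
  rw [add_comm t s]
  ext b
  rw [mul_apply_eq_comp, kernel_apply, kernel_apply, kernel_apply, ← ξ.mul_val,
    ← η.mul_val, ← (P.mul s t).map_left, (P.mul s t).ip_map, innerTensorForm_tmul]

theorem continuous_kernel_iff (ξ η : P.Unit) :
    Continuous (kernel ξ η) ↔ Tendsto (kernel ξ η) (𝓝 0) (𝓝 1) := by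
  refine ⟨fun h => kernel_zero ξ η ▸ h.tendsto 0, fun h =>
    continuous_of_add_eq_mul (kernel_zero ξ η) (kernel_add ξ η) ?_⟩
  rwa [ContinuousAt, kernel_zero]

theorem norm_sub_sq_eq (ξ η : P.Unit) (t : ℝ≥0) :
    ‖ξ.val t - η.val t‖ ^ 2 =
      ‖(kernel ξ ξ t 1 - kernel ξ η t 1) - (kernel η ξ t 1 - kernel η η t 1)‖ := by
  have hr (x y z : E t) : ip B x (y - z) = ip B x y - ip B x z := by simp [ip]
  have hl (x y z : E t) : ip B (x - y) z = ip B x z - ip B y z := by simp [ip]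
  rw [norm_sq_eq (B := B), hl, hr, hr]
  simp only [kernel_apply, one_smul]

theorem norm_kernel_sub_le (ξ η : P.Unit) (t : ℝ≥0) :
    ‖kernel ξ η t - kernel ξ ξ t‖ ≤ ‖ξ.val t‖ * ‖η.val t - ξ.val t‖ := by
  refine ContinuousLinearMap.opNorm_le_bound _ (by positivity) fun b => ?_
  have h : (kernel ξ η t - kernel ξ ξ t) b = ip B (ξ.val t) (b • (η.val t - ξ.val t)) := by
    rw [smul_sub]
    simp [ip]
  rw [h, mul_assoc, mul_comm ‖η.val t - ξ.val t‖]
  exact (norm_ip_le _ _).trans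
    (mul_le_mul_of_nonneg_left (norm_smul_le' b _) (norm_nonneg _))

theorem Unit.isContinuous_iff (ξ : P.Unit) : ξ.IsContinuous ↔ Continuous (kernel ξ ξ) := by
  simp [Unit.IsContinuous, IsContinuousSet]

theorem continuous_kernel_of_tendsto_norm_sub {ξ η : P.Unit} (hξ : ξ.IsContinuous)
    (h : Tendsto (fun t => ‖ξ.val t - η.val t‖) (𝓝 0) (𝓝 0)) : Continuous (kernel ξ η) := by
  have hK := (continuous_kernel_iff ξ ξ).1 (ξ.isContinuous_iff.1 hξ)
  -- `‖ξ t‖ ^ 2 = ‖kernel ξ ξ t 1‖`, so `‖ξ t‖` converges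
  have hnorm : Tendsto (fun t => ‖ξ.val t‖) (𝓝 0) (𝓝 (Real.sqrt ‖(1 : B)‖)) := by
    have h1 : Tendsto (fun t => kernel ξ ξ t 1) (𝓝 0) (𝓝 (1 : B)) :=
      ((ContinuousLinearMap.apply ℂ B (1 : B)).continuous.tendsto _).comp hK
    refine h1.norm.sqrt.congr fun t => ?_
    rw [kernel_apply, one_smul, ← norm_sq_eq, Real.sqrt_sq (norm_nonneg _)]
  have hdiff : Tendsto (fun t => kernel ξ η t - kernel ξ ξ t) (𝓝 0) (𝓝 0) := by
    refine squeeze_zero_norm (norm_kernel_sub_le ξ η) ?_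
    simpa [norm_sub_rev] using hnorm.mul h
  rw [continuous_kernel_iff]
  simpa using hdiff.add hK

/-- Two continuous units form a continuous set if and only if they approach each other in norm as
`t → 0`. -/
theorem isContinuousSet_pair_iff {ξ η : P.Unit} (hξ : ξ.IsContinuous) (hη : η.IsContinuous) :
    IsContinuousSet {ξ, η} ↔ Tendsto (fun t => ‖ξ.val t - η.val t‖) (𝓝 0) (𝓝 0) := by
  refine ⟨fun h => ?_, fun h => ?_⟩
  · have hk {α β : P.Unit} (hα : α ∈ ({ξ, η} : Set P.Unit)) (hβ : β ∈ ({ξ, η} : Set P.Unit)) :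
        Tendsto (fun t => kernel α β t 1) (𝓝 0) (𝓝 (1 : B)) :=
      ((ContinuousLinearMap.apply ℂ B (1 : B)).continuous.tendsto _).comp
        ((continuous_kernel_iff α β).1 (h α hα β hβ))
    have hξ' : ξ ∈ ({ξ, η} : Set P.Unit) := by simp
    have hη' : η ∈ ({ξ, η} : Set P.Unit) := by simp
    have := (((hk hξ' hξ').sub (hk hξ' hη')).sub ((hk hη' hξ').sub (hk hη' hη'))).norm.sqrt
    simp only [sub_self, norm_zero, Real.sqrt_zero] at this
    refine this.congr fun t => ?_
    rw [← norm_sub_sq_eq, Real.sqrt_sq (norm_nonneg _)]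
  · rintro α (rfl | rfl) β (rfl | rfl)
    · exact (Unit.isContinuous_iff _).1 hξ
    · exact continuous_kernel_of_tendsto_norm_sub hξ h
    · exact continuous_kernel_of_tendsto_norm_sub hη (by simpa only [norm_sub_rev] using h)
    · exact (Unit.isContinuous_iff _).1 hη

theorem IsContinuousSet.mono {S T : Set P.Unit} (hT : IsContinuousSet T) (h : S ⊆ T) :
    IsContinuousSet S :=
  fun ξ hξ η hη => hT ξ (h hξ) η (h hη)

theorem IsContinuousSet.isContinuous {S : Set P.Unit} (hS : IsContinuousSet S) {ξ : P.Unit}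
    (hξ : ξ ∈ S) : ξ.IsContinuous :=
  hS.mono (Set.singleton_subset_iff.2 hξ)

theorem IsContinuousSet.pair {S : Set P.Unit} (hS : IsContinuousSet S) {ξ η : P.Unit}
    (hξ : ξ ∈ S) (hη : η ∈ S) : IsContinuousSet {ξ, η} :=
  hS.mono (Set.pair_subset hξ hη)

theorem IsContinuousSet.pair_trans {ξ η ζ : P.Unit} (h : IsContinuousSet {ξ, η})
    (h' : IsContinuousSet {η, ζ}) : IsContinuousSet {ξ, ζ} := by
  have hξ : ξ.IsContinuous := h.isContinuous (by simp)
  have hη : η.IsContinuous := h.isContinuous (by simp)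
  have hζ : ζ.IsContinuous := h'.isContinuous (by simp)
  rw [isContinuousSet_pair_iff hξ hη] at h
  rw [isContinuousSet_pair_iff hη hζ] at h'
  rw [isContinuousSet_pair_iff hξ hζ]
  exact squeeze_zero (fun _ => norm_nonneg _)
    (fun t => norm_sub_le_norm_sub_add_norm_sub (ξ.val t) (η.val t) (ζ.val t))
    (by simpa using h.add h')

theorem isContinuousSet_class (ω : P.Unit) :
    IsContinuousSet {ξ : P.Unit | ξ.IsContinuous ∧ IsContinuousSet {ξ, ω}} := by
  intro ξ hξ η hη
  exact (hξ.2.pair_trans (Set.pair_comm η ω ▸ hη.2)) ξ (by simp) η (by simp)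

theorem Unit.IsContinuous.mem_class {ω : P.Unit} (hω : ω.IsContinuous) :
    ω ∈ {ξ : P.Unit | ξ.IsContinuous ∧ IsContinuousSet {ξ, ω}} :=
  ⟨hω, by rwa [Set.pair_eq_singleton]⟩

theorem IsContinuousSet.subset_class {S : Set P.Unit} (hS : IsContinuousSet S) {ω : P.Unit}
    (hω : ω ∈ S) : S ⊆ {ξ : P.Unit | ξ.IsContinuous ∧ IsContinuousSet {ξ, ω}} :=
  fun _ hξ => ⟨hS.isContinuous hξ, hS.pair hξ hω⟩

theorem maximal_isContinuousSet_class {ω : P.Unit} (hω : ω.IsContinuous) :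
    Maximal IsContinuousSet {ξ : P.Unit | ξ.IsContinuous ∧ IsContinuousSet {ξ, ω}} :=
  ⟨isContinuousSet_class ω, fun _ hT h => hT.subset_class (h hω.mem_class)⟩

/-- A maximal continuous set is the class of each of its members. -/
theorem eq_class_of_maximal {S : Set P.Unit} (hS : Maximal IsContinuousSet S) {ω : P.Unit}
    (hω : ω ∈ S) : S = {ξ : P.Unit | ξ.IsContinuous ∧ IsContinuousSet {ξ, ω}} :=
  hS.eq_of_subset (isContinuousSet_class ω) (hS.prop.subset_class hω)

end ProductSystem
theorem mainTheorem11 {B : Type u} [CStarAlgebra B] [PartialOrder B] [StarOrderedRing B]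
    {E : ℝ≥0 → Type v} [∀ t, NormedAddCommGroup (E t)] [∀ t, NormedSpace ℂ (E t)]
    [∀ t, Module B (E t)] [∀ t, Module Bᵐᵒᵖ (E t)] [∀ t, HilbertBimodule B (E t)]
    (P : ProductSystem B E) :
    -- being jointly continuous is an equivalence relation on the continuous units
    Equivalence (fun x y : {ξ : P.Unit // ξ.IsContinuous} =>
      ProductSystem.IsContinuousSet {x.1, y.1}) ∧
    -- its classes are exactly the nonempty maximal continuous sets of units
    (∀ S : Set P.Unit, (S.Nonempty ∧ Maximal ProductSystem.IsContinuousSet S) ↔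
      ∃ ω : P.Unit, ω.IsContinuous ∧
        S = {ξ | ξ.IsContinuous ∧ ProductSystem.IsContinuousSet {ξ, ω}}) ∧
    -- these are mutually disjoint and their union is the set of all continuous units
    {S : Set P.Unit | S.Nonempty ∧ Maximal ProductSystem.IsContinuousSet S}.PairwiseDisjoint id ∧
    ⋃₀ {S : Set P.Unit | S.Nonempty ∧ Maximal ProductSystem.IsContinuousSet S} =
      {ξ : P.Unit | ξ.IsContinuous} := by
  refine ⟨⟨fun x => ?_, fun {x y} h => ?_, fun h h' => h.pair_trans h'⟩, fun S => ?_, ?_, ?_⟩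
  · rw [Set.pair_eq_singleton]
    exact x.2
  · rwa [Set.pair_comm]
  · constructor
    · rintro ⟨⟨ω, hω⟩, hS⟩
      exact ⟨ω, hS.prop.isContinuous hω, ProductSystem.eq_class_of_maximal hS hω⟩
    · rintro ⟨ω, hω, rfl⟩
      exact ⟨⟨ω, hω.mem_class⟩, ProductSystem.maximal_isContinuousSet_class hω⟩
  · rintro S ⟨-, hS⟩ T ⟨-, hT⟩ hne
    refine Set.disjoint_left.2 fun ω hωS hωT => hne ?_
    rw [ProductSystem.eq_class_of_maximal hS hωS, ProductSystem.eq_class_of_maximal hT hωT]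
  · ext ω
    constructor
    · rintro ⟨S, ⟨-, hS⟩, hω⟩
      exact hS.prop.isContinuous hω
    · intro hω
      exact ⟨_, ⟨⟨ω, hω.mem_class⟩, ProductSystem.maximal_isContinuousSet_class hω⟩,
        hω.mem_class⟩
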